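/- Let four bodies with masses $m_1,m_2,m_3,m_4>0$ have positions $q_1,\dots,q_4$ in a Euclidean space $\mathbb{R}^d$ (in particular $d=2$ or $d=3$), and let $r_{ij}=\|q_i-q_j\|$. The configuration is a (Newtonian) central configuration if the points are distinct and there is a real $\lambda$ with $$\lambda\, m_i\,(q_i-q_{CM})=\sum_{j\ne i}\frac{m_i m_j\,(q_j-q_i)}{r_{ij}^3}\quad (1\le i\le 4),\qquad q_{CM}=\frac{\sum_i m_i q_i}{\sum_i m_i}.$$ It is a standard convex planar configuration if the four points lie in a plane, no two coincide, no three are collinear, none lies in the convex hull of the other three, and they are numbered consecutively along the boundary of their convex quadrilateral, so that $r_{12},r_{23},r_{34},r_{14}$ are the lengths of its sides and $r_{13},r_{24}$ those of its diagonals. **Proposition.** Suppose that we have a standard convex planar central configuration with $m_1=m_2$ and $m_3=m_4$. Then $$r_{13}=r_{24}\quad\text{if and only if}\quad r_{14}=r_{23}.$$ In this case the configuration is an isosceles trapezoid with bodies $1$ and $2$ on one base and bodies $3$ and $4$ on the other. (An isosceles trapezoid is a convex quadrilateral with two parallel sides, the bases, whose other two sides have equal length and whose angles at a base are equal; rectangles,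 in particular squares, are included.) -/

import Mathlib

/-- The centre of mass of bodies with masses `m i` at the positions `q i`. -/
noncomputable def centerOfMass {n d : ℕ} (m : Fin n → ℝ)
    (q : Fin n → EuclideanSpace ℝ (Fin d)) : EuclideanSpace ℝ (Fin d) :=
  (∑ i, m i)⁻¹ • ∑ i, m i • q i

/-- The positions `q i` form a Newtonian central configuration for the masses `m i`:
no two bodies coincide, and for some real `lam` every body satisfies
`lam m_i (q_i - q_CM) = ∑_{j ≠ i} m_i m_j (q_j - q_i) / r_{ij}^3`. -/
def IsCentralConfiguration {n d : ℕ} (m : Fin n → ℝ)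
    (q : Fin n → EuclideanSpace ℝ (Fin d)) : Prop :=
  Function.Injective q ∧
    ∃ lam : ℝ, ∀ i, (lam * m i) • (q i - centerOfMass m q) =
      ∑ j ∈ Finset.univ.erase i, (m i * m j / dist (q i) (q j) ^ 3) • (q j - q i)

/-- No two points coincide and no three of them lie on a line. -/
def IsNondegenerate {n d : ℕ} (q : Fin n → EuclideanSpace ℝ (Fin d)) : Prop :=
  Function.Injective q ∧
    ∀ i j k, i ≠ j → i ≠ k → j ≠ k → ¬ Collinear ℝ {q i, q j, q k}

/-- No point lies in the convex hull of the others. -/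
def IsConvexConfiguration {n d : ℕ} (q : Fin n → EuclideanSpace ℝ (Fin d)) : Prop :=
  ∀ i, q i ∉ convexHull ℝ (q '' {i}ᶜ)

/-- The points are numbered consecutively along the boundary of the quadrilateral: each of the
segments from `q i` to `q (i + 1)` (indices modulo `4`) is an exterior side, that is, the other
two points lie strictly on the same side of the line through it. The remaining two segments,
from `q 0` to `q 2` and from `q 1` to `q 3`, are then the diagonals. -/
def IsOrderedSequentially {d : ℕ} (q : Fin 4 → EuclideanSpace ℝ (Fin d)) : Prop :=
  ∀ i : Fin 4, (affineSpan ℝ {q i, q (i + 1)}).SSameSide (q (i + 2)) (q (i + 3))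

/-- A standard convex planar configuration of four points. -/
structure IsStandardConvex {d : ℕ} (q : Fin 4 → EuclideanSpace ℝ (Fin d)) : Prop where
  planar : Coplanar ℝ (Set.range q)
  nondegenerate : IsNondegenerate q
  convex : IsConvexConfiguration q
  ordered : IsOrderedSequentially q

/-- The convex quadrilateral with consecutive vertices `q 0, q 1, q 2, q 3` is an isosceles
trapezoid with bases `q 0 q 1` and `q 2 q 3`: the bases are parallel, the legs have equal
length, and the two angles at the base `q 0 q 1` are equal. Rectangles are included;
other parallelograms are not. -/
structure IsIsoscelesTrapezoid {d : ℕ} (q : Fin 4 → EuclideanSpace ℝ (Fin d)) : Prop where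
  standard : IsStandardConvex q
  bases_parallel : (affineSpan ℝ {q 0, q 1}).Parallel (affineSpan ℝ {q 2, q 3})
  legs_eq : dist (q 0) (q 3) = dist (q 1) (q 2)
  base_angles_eq :
    EuclideanGeometry.angle (q 3) (q 0) (q 1) = EuclideanGeometry.angle (q 0) (q 1) (q 2)

/-! Let `w` be an affine dependence of the vertices; convexity gives it the signs +, −, +, −.
Dziobek's relations say that `m i * m j * (1 / r_ij ^ 3 - c)` equals `κ * (w i * w j)`, and
`dziobek_multiplier_neg` gives `κ < 0`. With the masses equal in pairs, equal legs mean `w 0 * w 3 =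
w 1 * w 2`, and equal diagonals mean `w 0 * w 2 = w 1 * w 3`. As `w` sums to zero, each equation
factors. Equal legs force `w 0 = -w 1` and `w 2 = -w 3`, which gives back both equalities and makes
the bases parallel. Equal diagonals also allow `w 3 = -w 0`; there the four masses turn out equal,
and `eq_of_inv_cube_eq` leads back to the first case. -/

/-! ### Affine dependences of the vertices -/

/-- Coefficients `w` of an affine dependence among the points `q i`. -/
def IsAffineDependence {n d : ℕ} (q : Fin n → EuclideanSpace ℝ (Fin d)) (w : Fin n → ℝ) : Prop :=
  ∑ i, w i = 0 ∧ ∑ i, w i • q i = 0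

theorem exists_dependence_of_sSameSide {V : Type*} [AddCommGroup V] [Module ℝ V] {a b c e : V}
    (h : (affineSpan ℝ {a, b}).SSameSide c e) :
    ∃ x y z t : ℝ, 0 < z ∧ t < 0 ∧ x + y + z + t = 0 ∧
      x • a + y • b + z • c + t • e = 0 := by
  obtain ⟨⟨p₁, hp₁, p₂, hp₂, hray⟩, hc, he⟩ := h
  have h1 : c -ᵥ p₁ ≠ 0 := fun h0 => hc (by rwa [vsub_eq_zero_iff_eq.1 h0])
  have h2 : e -ᵥ p₂ ≠ 0 := fun h0 => he (by rwa [vsub_eq_zero_iff_eq.1 h0])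
  obtain ⟨r, s, hr, hs, hrs⟩ := hray.exists_pos h1 h2
  obtain ⟨u, rfl⟩ := mem_affineSpan_pair_iff_exists_lineMap_eq.1 hp₁
  obtain ⟨v, rfl⟩ := mem_affineSpan_pair_iff_exists_lineMap_eq.1 hp₂
  refine ⟨-r * (1 - u) + s * (1 - v), -r * u + s * v, r, -s, hr, by linarith, by ring, ?_⟩
  simp only [AffineMap.lineMap_apply_module, vsub_eq_sub] at hrs
  rw [← sub_eq_zero] at hrs
  rw [← hrs]
  module

theorem IsNondegenerate.dependence_eq_zero {d : ℕ} {q : Fin 4 → EuclideanSpace ℝ (Fin d)}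
    (hq : IsNondegenerate q) {w : Fin 4 → ℝ} (hw : IsAffineDependence q w) {l : Fin 4}
    (hl : w l = 0) (i : Fin 4) : w i = 0 := by
  have key : ∀ a b c : Fin 4, a ≠ b → a ≠ c → b ≠ c → w a + w b + w c = 0 →
      w a • q a + w b • q b + w c • q c = 0 → w a = 0 ∧ w b = 0 ∧ w c = 0 := by
    intro a b c hab hac hbc h0 h1
    have hi := affineIndependent_iff_not_collinear_set.2 (hq.2 a b c hab hac hbc)
    have := affineIndependent_iff.1 hi Finset.univ ![w a, w b, w c]
      (by simpa [Fin.sum_univ_three] using h0) (by simpa [Fin.sum_univ_three] using h1)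
    exact ⟨this 0 (Finset.mem_univ _), this 1 (Finset.mem_univ _), this 2 (Finset.mem_univ _)⟩
  obtain ⟨h0, h1⟩ := hw
  rw [Fin.sum_univ_four] at h0 h1
  fin_cases l <;> simp only [Fin.zero_eta, Fin.mk_one, Fin.reduceFinMk] at hl <;>
    simp only [hl, zero_smul, zero_add, add_zero] at h0 h1
  · obtain ⟨h, h', h''⟩ := key 1 2 3 (by decide) (by decide) (by decide) h0 h1
    fin_cases i <;> assumption
  · obtain ⟨h, h', h''⟩ := key 0 2 3 (by decide) (by decide) (by decide) h0 h1
    fin_cases i <;> assumption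
  · obtain ⟨h, h', h''⟩ := key 0 1 3 (by decide) (by decide) (by decide) h0 h1
    fin_cases i <;> assumption
  · obtain ⟨h, h', h''⟩ := key 0 1 2 (by decide) (by decide) (by decide) h0 h1
    fin_cases i <;> assumption

/-- Affine dependences of four points, no three of them collinear, are proportional. -/
theorem IsNondegenerate.dependence_mul_comm {d : ℕ} {q : Fin 4 → EuclideanSpace ℝ (Fin d)}
    (hq : IsNondegenerate q) {u w : Fin 4 → ℝ} (hu : IsAffineDependence q u)
    (hw : IsAffineDependence q w) (j k : Fin 4) : u j * w k = u k * w j := by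
  have hdep : IsAffineDependence q (fun i => w j * u i - u j * w i) := by
    constructor
    · rw [Finset.sum_sub_distrib, ← Finset.mul_sum, ← Finset.mul_sum, hu.1, hw.1]
      simp
    · simp only [sub_smul, mul_smul]
      rw [Finset.sum_sub_distrib, ← Finset.smul_sum, ← Finset.smul_sum, hu.2, hw.2]
      simp
  have := hq.dependence_eq_zero hdep (l := j) (by ring) k
  linarith

/-- Each side yields a dependence with opposite signs at the two vertices off it. All dependences
are proportional, so three sides fix the alternating pattern. -/
theorem IsStandardConvex.exists_dependence {d : ℕ} {q : Fin 4 → EuclideanSpace ℝ (Fin d)}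
    (hq : IsStandardConvex q) :
    ∃ w, IsAffineDependence q w ∧ 0 < w 0 ∧ w 1 < 0 ∧ 0 < w 2 ∧ w 3 < 0 := by
  obtain ⟨x, y, z, t, hz, ht, h0, h1⟩ := exists_dependence_of_sSameSide (hq.ordered 0)
  obtain ⟨x', y', z', t', hz', ht', h0', h1'⟩ := exists_dependence_of_sSameSide (hq.ordered 1)
  obtain ⟨x₂, y₂, z₂, t₂, hz₂, ht₂, h0₂, h1₂⟩ := exists_dependence_of_sSameSide (hq.ordered 2)
  have hw : IsAffineDependence q ![x, y, z, t] := by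
    constructor
    · simpa [Fin.sum_univ_four] using h0
    · simpa [Fin.sum_univ_four] using h1
  have hu : IsAffineDependence q ![t', x', y', z'] := by
    constructor
    · simp [Fin.sum_univ_four]; linarith
    · simp [Fin.sum_univ_four]; rw [← h1']; simp; abel
  have hv : IsAffineDependence q ![z₂, t₂, x₂, y₂] := by
    constructor
    · simp [Fin.sum_univ_four]; linarith
    · simp [Fin.sum_univ_four]; rw [← h1₂]; simp; abel
  have e1 := hq.nondegenerate.dependence_mul_comm hu hw 0 3
  have e2 := hq.nondegenerate.dependence_mul_comm hv hw 0 1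
  simp at e1 e2
  have hx : 0 < x := by nlinarith [mul_pos_of_neg_of_neg ht' ht]
  have hy : y < 0 := by nlinarith [mul_neg_of_neg_of_pos ht₂ hx]
  exact ⟨_, hw, hx, hy, hz, ht⟩

/-- The weighted sum of the squared distances to a point does not depend on the point, when the
weights form an affine dependence. -/
theorem IsAffineDependence.sum_mul_dist_sq {n d : ℕ} {q : Fin n → EuclideanSpace ℝ (Fin d)}
    {w : Fin n → ℝ} (hw : IsAffineDependence q w) (p : EuclideanSpace ℝ (Fin d)) :
    ∑ i, w i * dist p (q i) ^ 2 = ∑ i, w i * ‖q i‖ ^ 2 := by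
  have h1 : ∀ i, w i * dist p (q i) ^ 2 =
      ‖p‖ ^ 2 * w i - 2 * inner ℝ p (w i • q i) + w i * ‖q i‖ ^ 2 := by
    intro i
    rw [dist_eq_norm, norm_sub_sq_real, real_inner_smul_right]
    ring
  simp only [h1, Finset.sum_add_distrib, Finset.sum_sub_distrib, ← Finset.mul_sum, ← inner_sum,
    hw.1, hw.2]
  simp

/-! ### Dziobek's relations -/

/-- Dziobek's relations: in a central configuration of four points, no three of them collinear,
`r_{ij}^{-3} - c` is proportional to `w_i w_j / (m_i m_j)`. -/
theorem IsCentralConfiguration.exists_dziobek {d : ℕ} {m : Fin 4 → ℝ}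
    {q : Fin 4 → EuclideanSpace ℝ (Fin d)} (hm : ∀ i, 0 < m i) (hcc : IsCentralConfiguration m q)
    (hq : IsNondegenerate q) {w : Fin 4 → ℝ} (hw : IsAffineDependence q w) (hw0 : ∀ i, w i ≠ 0) :
    ∃ c κ : ℝ, ∀ i j, i ≠ j → m i * m j * (1 / dist (q i) (q j) ^ 3 - c) = κ * (w i * w j) := by
  obtain ⟨-, lam, hlam⟩ := hcc
  have hM : 0 < ∑ i, m i := Finset.sum_pos (fun i _ => hm i) Finset.univ_nonempty
  set M := ∑ i, m i with hMdef
  -- The shift by `-lam / M` absorbs the centre-of-mass term. The diagonal values `S i i` are junk,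
  -- but they only ever multiply `q i - q i = 0`.
  set S : Fin 4 → Fin 4 → ℝ := fun i j => 1 / dist (q i) (q j) ^ 3 - (-lam / M) with hS
  have hS_comm : ∀ i j, S i j = S j i := fun i j => by simp only [hS, dist_comm]
  have hforce : ∀ i, ∑ j, (m j * S i j) • (q j - q i) = 0 := by
    intro i
    have hc : q i - centerOfMass m q = -(M⁻¹ • ∑ j, m j • (q j - q i)) := by
      simp only [centerOfMass, smul_sub, Finset.sum_sub_distrib, ← Finset.sum_smul, ← hMdef]
      rw [inv_smul_smul₀ hM.ne']
      abel
    have h := hlam i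
    rw [Finset.sum_erase _ (by simp), hc] at h
    have h2 : m i • ∑ j, (m j * S i j) • (q j - q i) = 0 := by
      rw [← sub_eq_zero] at h
      rw [← neg_eq_zero, ← h]
      simp only [Finset.smul_sum, smul_smul, ← Finset.sum_neg_distrib, ← Finset.sum_sub_distrib,
        ← smul_neg, smul_smul, hS]
      refine Finset.sum_congr rfl fun j _ => ?_
      module
    exact (smul_eq_zero.1 h2).resolve_left (hm i).ne'
  have hdep : ∀ i, IsAffineDependence q
      (fun j => m j * S i j - if j = i then ∑ k, m k * S i k else 0) := by
    intro i
    constructor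
    · simp [Finset.sum_sub_distrib]
    · rw [← hforce i]
      simp [sub_smul, Finset.sum_sub_distrib, smul_sub, Finset.sum_smul, ite_smul]
  have hk : ∀ i, ∃ k, ∀ j, j ≠ i → m j * S i j = k * w j := by
    intro i
    refine ⟨(m i * S i i - ∑ k, m k * S i k) / w i, fun j hj => ?_⟩
    have := hq.dependence_mul_comm (hdep i) hw j i
    simp only [hj, if_false, if_true, sub_zero] at this
    rw [div_mul_eq_mul_div, eq_div_iff (hw0 i), this]
  choose k hk using hk
  refine ⟨-lam / M, m 0 * k 0 / w 0, fun i j hij => ?_⟩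
  -- Symmetry of `S` makes `m l * k l` proportional to `w l`.
  have hκ : ∀ l, m l * k l = m 0 * k 0 / w 0 * w l := by
    intro l
    rcases eq_or_ne l 0 with rfl | hl
    · rw [div_mul_cancel₀ _ (hw0 0)]
    · rw [div_mul_eq_mul_div, eq_div_iff (hw0 0)]
      have e1 := hk 0 l hl
      have e2 := hk l 0 hl.symm
      rw [hS_comm] at e2
      linear_combination (-m l) * e2 + m 0 * e1
  have e := hk i j hij.symm
  have e' := hκ i
  change m i * m j * S i j = _
  linear_combination m i * e + w j * e'

/-! ### Inverse cubes and the sign of the multiplier -/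

/-- Clearing denominators, `a` and `b` are roots of `s ^ 3 * c + K * (a * x) ^ 2 * s = 1`, whose
left side is strictly increasing for `s > 0`. -/
theorem eq_of_inv_cube_eq {a b x y c K : ℝ} (ha : 0 < a) (hb : 0 < b) (hx : 0 < x)
    (hc : 0 < c) (hK : 0 < K) (hab : a * x = b * y) (h1 : 1 / a ^ 3 - c = K * x ^ 2)
    (h2 : 1 / b ^ 3 - c = K * y ^ 2) : x = y := by
  have e1 : a ^ 3 * c + K * (a * x) ^ 2 * a = 1 := by
    have : (1 / a ^ 3) * a ^ 3 = 1 := by field_simp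
    linear_combination this - a ^ 3 * h1
  have e2 : b ^ 3 * c + K * (b * y) ^ 2 * b = 1 := by
    have : (1 / b ^ 3) * b ^ 3 = 1 := by field_simp
    linear_combination this - b ^ 3 * h2
  rw [← hab] at e2
  have hp : 0 < K * (a * x) ^ 2 := by positivity
  have hlt : ∀ s t : ℝ, 0 < s → s < t →
      s ^ 3 * c + K * (a * x) ^ 2 * s < t ^ 3 * c + K * (a * x) ^ 2 * t := by
    intro s t hs hst
    have : s ^ 3 < t ^ 3 := by gcongr
    gcongr
  rcases lt_trichotomy a b with h | h | h
  · linarith [hlt a b ha h]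
  · subst h
    exact mul_left_cancel₀ ha.ne' hab
  · linarith [hlt b a hb h]

theorem le_of_inv_cube_le {a b : ℝ} (ha : 0 < a) (hb : 0 < b) (h : 1 / a ^ 3 ≤ 1 / b ^ 3) :
    b ≤ a :=
  le_of_pow_le_pow_left₀ three_ne_zero ha.le
    ((one_div_le_one_div (by positivity) (by positivity)).1 h)

theorem eq_of_inv_cube_sub_eq {a b c : ℝ} (ha : 0 < a) (hb : 0 < b)
    (h : 1 / a ^ 3 - c = 1 / b ^ 3 - c) : a = b :=
  le_antisymm (le_of_inv_cube_le hb ha (by linarith)) (le_of_inv_cube_le ha hb (by linarith))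

/-- The multiplier in Dziobek's relations of a convex configuration is negative, stated for the
six mutual distances. -/
theorem dziobek_multiplier_neg {m₀ m₁ m₂ m₃ w₀ w₁ w₂ w₃ r₀₁ r₀₂ r₀₃ r₁₂ r₁₃ r₂₃ c κ : ℝ}
    (hm₀ : 0 < m₀) (hm₁ : 0 < m₁) (hm₂ : 0 < m₂) (hm₃ : 0 < m₃)
    (hw₀ : 0 < w₀) (hw₁ : w₁ < 0) (hw₂ : 0 < w₂) (hw₃ : w₃ < 0) (hsum : w₀ + w₁ + w₂ + w₃ = 0)
    (h₀₁ : 0 < r₀₁) (h₀₂ : 0 < r₀₂) (h₀₃ : 0 < r₀₃) (h₁₂ : 0 < r₁₂) (h₁₃ : 0 < r₁₃) (h₂₃ : 0 < r₂₃)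
    (d₀₁ : m₀ * m₁ * (1 / r₀₁ ^ 3 - c) = κ * (w₀ * w₁))
    (d₀₂ : m₀ * m₂ * (1 / r₀₂ ^ 3 - c) = κ * (w₀ * w₂))
    (d₀₃ : m₀ * m₃ * (1 / r₀₃ ^ 3 - c) = κ * (w₀ * w₃))
    (d₁₂ : m₁ * m₂ * (1 / r₁₂ ^ 3 - c) = κ * (w₁ * w₂))
    (d₁₃ : m₁ * m₃ * (1 / r₁₃ ^ 3 - c) = κ * (w₁ * w₃))
    (d₂₃ : m₂ * m₃ * (1 / r₂₃ ^ 3 - c) = κ * (w₂ * w₃))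
    (hquad : w₀ * w₁ * r₀₁ ^ 2 + w₀ * w₂ * r₀₂ ^ 2 + w₀ * w₃ * r₀₃ ^ 2 + w₁ * w₂ * r₁₂ ^ 2 +
      w₁ * w₃ * r₁₃ ^ 2 + w₂ * w₃ * r₂₃ ^ 2 = 0) : κ < 0 := by
  by_contra! hκ
  have side : ∀ {a b x y r : ℝ}, 0 < a → 0 < b → x * y < 0 →
      a * b * (1 / r ^ 3 - c) = κ * (x * y) → 1 / r ^ 3 ≤ c := by
    intro a b x y r ha hb hxy h
    have := mul_nonpos_of_nonneg_of_nonpos hκ hxy.le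
    rw [← h] at this
    linarith [nonpos_of_mul_nonpos_right this (mul_pos ha hb)]
  have diag : ∀ {a b x y r : ℝ}, 0 < a → 0 < b → 0 < x * y →
      a * b * (1 / r ^ 3 - c) = κ * (x * y) → c ≤ 1 / r ^ 3 := by
    intro a b x y r ha hb hxy h
    have := mul_nonneg hκ hxy.le
    rw [← h] at this
    linarith [nonneg_of_mul_nonneg_right this (mul_pos ha hb)]
  have n₀₁ := mul_neg_of_pos_of_neg hw₀ hw₁
  have n₀₃ := mul_neg_of_pos_of_neg hw₀ hw₃
  have n₁₂ := mul_neg_of_neg_of_pos hw₁ hw₂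
  have n₂₃ := mul_neg_of_pos_of_neg hw₂ hw₃
  have p₀₂ := mul_pos hw₀ hw₂
  have p₁₃ := mul_pos_of_neg_of_neg hw₁ hw₃
  -- If `κ ≥ 0`, no side is shorter than the longer diagonal `ρ`. Replacing every distance by `ρ`
  -- can then only increase the quadratic form, yet the result is negative.
  obtain ⟨ρ, hρ, hρ₀₂, hρ₁₃, hρc⟩ :
      ∃ ρ : ℝ, 0 < ρ ∧ r₀₂ ≤ ρ ∧ r₁₃ ≤ ρ ∧ c ≤ 1 / ρ ^ 3 := by
    rcases le_total r₀₂ r₁₃ with h | h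
    · exact ⟨r₁₃, h₁₃, h, le_rfl, diag hm₁ hm₃ p₁₃ d₁₃⟩
    · exact ⟨r₀₂, h₀₂, le_rfl, h, diag hm₀ hm₂ p₀₂ d₀₂⟩
  have sq : ∀ {a b x y r : ℝ}, 0 < a → 0 < b → 0 < r → x * y < 0 →
      a * b * (1 / r ^ 3 - c) = κ * (x * y) → x * y * r ^ 2 ≤ x * y * ρ ^ 2 := by
    intro a b x y r ha hb hr hxy h
    have : ρ ≤ r := le_of_inv_cube_le hr hρ ((side ha hb hxy h).trans hρc)
    have : ρ ^ 2 ≤ r ^ 2 := by gcongr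
    exact mul_le_mul_of_nonpos_left this hxy.le
  have s₀₁ := sq hm₀ hm₁ h₀₁ n₀₁ d₀₁
  have s₀₃ := sq hm₀ hm₃ h₀₃ n₀₃ d₀₃
  have s₁₂ := sq hm₁ hm₂ h₁₂ n₁₂ d₁₂
  have s₂₃ := sq hm₂ hm₃ h₂₃ n₂₃ d₂₃
  have s₀₂ : w₀ * w₂ * r₀₂ ^ 2 ≤ w₀ * w₂ * ρ ^ 2 := by gcongr
  have s₁₃ : w₁ * w₃ * r₁₃ ^ 2 ≤ w₁ * w₃ * ρ ^ 2 := by gcongr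
  have hneg : 0 < (w₀ ^ 2 + w₁ ^ 2 + w₂ ^ 2 + w₃ ^ 2) * ρ ^ 2 := by positivity
  have hid : 2 * (w₀ * w₁ + w₀ * w₂ + w₀ * w₃ + w₁ * w₂ + w₁ * w₃ + w₂ * w₃) * ρ ^ 2 =
      -(w₀ ^ 2 + w₁ ^ 2 + w₂ ^ 2 + w₃ ^ 2) * ρ ^ 2 := by
    linear_combination (w₀ + w₁ + w₂ + w₃) * ρ ^ 2 * hsum
  linarith

/-! ### The trapezoid and the equivalence -/

/-- Four points with distances as in an isosceles trapezoid, and bases in proportion, form one. -/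
theorem IsStandardConvex.isIsoscelesTrapezoid {d : ℕ} {q : Fin 4 → EuclideanSpace ℝ (Fin d)}
    (hq : IsStandardConvex q) {s t : ℝ} (hs : s ≠ 0) (ht : t ≠ 0)
    (hpar : s • (q 1 - q 0) = t • (q 3 - q 2))
    (hdiag : dist (q 0) (q 2) = dist (q 1) (q 3)) (hlegs : dist (q 0) (q 3) = dist (q 1) (q 2)) :
    IsIsoscelesTrapezoid q where
  standard := hq
  bases_parallel := by
    rw [AffineSubspace.affineSpan_pair_parallel_iff_vectorSpan_eq, vectorSpan_pair_rev, vectorSpan_pair_rev,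
      vsub_eq_sub, vsub_eq_sub, ← Submodule.span_singleton_smul_eq (IsUnit.mk0 s hs), hpar,
      Submodule.span_singleton_smul_eq (IsUnit.mk0 t ht)]
  legs_eq := hlegs
  base_angles_eq := by
    -- The triangles `q 3, q 0, q 1` and `q 2, q 1, q 0` have equal sides; the law of cosines
    -- compares their angles.
    have h : inner ℝ (q 3 - q 0) (q 1 - q 0) = inner ℝ (q 0 - q 1) (q 2 - q 1) := by
      rw [real_inner_eq_norm_mul_self_add_norm_mul_self_sub_norm_sub_mul_self_div_two,
        real_inner_eq_norm_mul_self_add_norm_mul_self_sub_norm_sub_mul_self_div_two,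
        sub_sub_sub_cancel_right, sub_sub_sub_cancel_right]
      simp only [← dist_eq_norm]
      rw [dist_comm (q 3) (q 0), dist_comm (q 3) (q 1), dist_comm (q 1) (q 0), dist_comm (q 2) (q 1),
        hlegs, hdiag]
      ring
    simp only [EuclideanGeometry.angle, InnerProductGeometry.angle, vsub_eq_sub, h]
    simp only [← dist_eq_norm]
    rw [dist_comm (q 3) (q 0), dist_comm (q 1) (q 0), dist_comm (q 2) (q 1), hlegs,
      mul_comm (dist (q 1) (q 2))]

theorem eq_neg_and_eq_neg_of_mul_eq {x y z t : ℝ} (hy : y < 0) (ht : t < 0)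
    (hsum : x + y + z + t = 0) (h : x * t = y * z) : x = -y ∧ z = -t := by
  have h1 : (x + y) * (y + t) = 0 := by linear_combination y * hsum + h
  have hx : x + y = 0 := (mul_eq_zero.1 h1).resolve_right (by linarith)
  constructor <;> linarith

/-- The bodies `1, 2, 3, 4` have the indices `0, 1, 2, 3`. -/
theorem mainTheorem4 {d : ℕ} (m : Fin 4 → ℝ) (q : Fin 4 → EuclideanSpace ℝ (Fin d))
    (hm : ∀ i, 0 < m i) (hcc : IsCentralConfiguration m q) (hq : IsStandardConvex q)
    (h12 : m 0 = m 1) (h34 : m 2 = m 3) :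
    (dist (q 0) (q 2) = dist (q 1) (q 3) ↔ dist (q 0) (q 3) = dist (q 1) (q 2)) ∧
      ((dist (q 0) (q 2) = dist (q 1) (q 3) ∨ dist (q 0) (q 3) = dist (q 1) (q 2)) →
        IsIsoscelesTrapezoid q) := by
  obtain ⟨w, hw, hw₀, hw₁, hw₂, hw₃⟩ := hq.exists_dependence
  obtain ⟨c, κ, hD⟩ := hcc.exists_dziobek hm hq.nondegenerate hw
    (by intro i; fin_cases i <;> first | exact hw₀.ne' | exact hw₁.ne | exact hw₂.ne' | exact hw₃.ne)
  have hsum : w 0 + w 1 + w 2 + w 3 = 0 := by simpa [Fin.sum_univ_four] using hw.1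
  have pos : ∀ i j, i ≠ j → 0 < dist (q i) (q j) := fun i j hij =>
    dist_pos.2 (hq.nondegenerate.1.ne hij)
  have p₀₁ := pos 0 1 (by decide)
  have p₀₂ := pos 0 2 (by decide)
  have p₀₃ := pos 0 3 (by decide)
  have p₁₂ := pos 1 2 (by decide)
  have p₁₃ := pos 1 3 (by decide)
  have p₂₃ := pos 2 3 (by decide)
  have d₀₁ := hD 0 1 (by decide)
  have d₀₂ := hD 0 2 (by decide)
  have d₀₃ := hD 0 3 (by decide)
  have d₁₂ := hD 1 2 (by decide)
  have d₁₃ := hD 1 3 (by decide)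
  have d₂₃ := hD 2 3 (by decide)
  have f₀ := hw.sum_mul_dist_sq (q 0)
  have f₁ := hw.sum_mul_dist_sq (q 1)
  have f₂ := hw.sum_mul_dist_sq (q 2)
  have f₃ := hw.sum_mul_dist_sq (q 3)
  have hvec : w 0 • q 0 + w 1 • q 1 + w 2 • q 2 + w 3 • q 3 = 0 := by
    simpa [Fin.sum_univ_four] using hw.2
  set F := ∑ i, w i * ‖q i‖ ^ 2
  rw [Fin.sum_univ_four] at f₀ f₁ f₂ f₃
  rw [dist_self] at f₀ f₁ f₂ f₃
  rw [dist_comm (q 1) (q 0)] at f₁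
  rw [dist_comm (q 2) (q 0), dist_comm (q 2) (q 1)] at f₂
  rw [dist_comm (q 3) (q 0), dist_comm (q 3) (q 1), dist_comm (q 3) (q 2)] at f₃
  have hm₀ := hm 0
  have hm₂ := hm 2
  have hκ : κ < 0 := dziobek_multiplier_neg (hm 0) (hm 1) (hm 2) (hm 3) hw₀ hw₁ hw₂ hw₃ hsum
    p₀₁ p₀₂ p₀₃ p₁₂ p₁₃ p₂₃ d₀₁ d₀₂ d₀₃ d₁₂ d₁₃ d₂₃ (by
      linear_combination (w 0 * f₀ + w 1 * f₁ + w 2 * f₂ + w 3 * f₃ + F * hsum) / 2)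
  rw [← h12] at d₀₁ d₁₂ d₁₃
  rw [← h34] at d₀₃ d₁₃ d₂₃
  set r₀₁ := dist (q 0) (q 1)
  set r₀₂ := dist (q 0) (q 2)
  set r₀₃ := dist (q 0) (q 3)
  set r₁₂ := dist (q 1) (q 2)
  set r₁₃ := dist (q 1) (q 3)
  set r₂₃ := dist (q 2) (q 3)
  have hmm : m 0 * m 2 ≠ 0 := (mul_pos hm₀ hm₂).ne'
  have diag_legs : w 0 = -w 1 ∧ w 2 = -w 3 → r₀₂ = r₁₃ ∧ r₀₃ = r₁₂ := by
    rintro ⟨h, h'⟩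
    constructor
    · refine eq_of_inv_cube_sub_eq p₀₂ p₁₃ (mul_left_cancel₀ hmm (d₀₂.trans ?_ |>.trans d₁₃.symm))
      rw [h, h']; ring
    · refine eq_of_inv_cube_sub_eq p₀₃ p₁₂ (mul_left_cancel₀ hmm (d₀₃.trans ?_ |>.trans d₁₂.symm))
      rw [h, h']; ring
  have of_legs : r₀₃ = r₁₂ → w 0 = -w 1 ∧ w 2 = -w 3 := by
    intro h
    rw [h] at d₀₃
    exact eq_neg_and_eq_neg_of_mul_eq hw₁ hw₃ hsum
      (mul_left_cancel₀ hκ.ne (d₀₃.symm.trans d₁₂))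
  have of_diag : r₀₂ = r₁₃ → w 0 = -w 1 ∧ w 2 = -w 3 := by
    intro h
    have hprod : w 0 * w 2 = w 1 * w 3 := by
      rw [h] at d₀₂
      exact mul_left_cancel₀ hκ.ne (d₀₂.symm.trans d₁₃)
    have hfac : (w 0 + w 1) * (w 0 + w 3) = 0 := by linear_combination w 0 * hsum - hprod
    rcases mul_eq_zero.1 hfac with h0 | h0
    · constructor <;> linarith
    have e3 : w 3 = -w 0 := by linarith
    have e2 : w 2 = -w 1 := by linarith
    -- The other pair of sides is parallel; the masses are then equal and the figure a rectangle.
    rw [e3] at f₀ f₁ f₂ f₃ d₀₃ d₂₃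
    rw [e2] at f₀ f₁ f₂ f₃ d₁₂ d₂₃
    have hc : 0 < c := by
      have h1 : m 0 * m 2 * (1 / r₀₂ ^ 3 - c) < 0 := by
        rw [d₀₂]
        exact mul_neg_of_neg_of_pos hκ (mul_pos hw₀ hw₂)
      have h2 : 1 / r₀₂ ^ 3 - c < 0 := neg_of_mul_neg_right h1 (mul_pos hm₀ hm₂).le
      have h3 : 0 < 1 / r₀₂ ^ 3 := by positivity
      linarith
    rw [← h] at f₁ f₃
    have hlegs : r₀₁ = r₂₃ := by
      have : (w 1 - w 0) * (r₀₁ ^ 2 - r₂₃ ^ 2) = 0 := by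
        linear_combination f₀ - f₂ - f₁ + f₃
      have := (mul_eq_zero.1 this).resolve_left (by linarith)
      exact (pow_left_inj₀ p₀₁.le p₂₃.le two_ne_zero).1 (by linarith)
    -- These are the norms in `w 0 • (q 0 - q 3) = w 1 • (q 2 - q 1)`, recovered in squared form
    -- from the weighted distance sums.
    have hbase : r₀₃ * w 0 = r₁₂ * (-w 1) := by
      refine (pow_left_inj₀ (by positivity) (mul_nonneg p₁₂.le (by linarith)) two_ne_zero).1 ?_
      linear_combination (-w 0 * f₀ + w 0 * f₃ + w 1 * f₁ - w 1 * f₂) / 2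
    have hmass : m 2 = m 0 := by
      rw [← hlegs] at d₂₃
      have h1 : 0 < m 0 * m 0 * (1 / r₀₁ ^ 3 - c) := by
        rw [d₀₁]
        exact mul_pos_of_neg_of_neg hκ (mul_neg_of_pos_of_neg hw₀ hw₁)
      have h2 : 1 / r₀₁ ^ 3 - c ≠ 0 := fun hz => by rw [hz, mul_zero] at h1; exact h1.false
      have h3 : m 2 * m 2 = m 0 * m 0 :=
        mul_right_cancel₀ h2 (by linear_combination d₂₃ - d₀₁)
      exact (mul_self_inj hm₂.le hm₀.le).1 h3
    rw [hmass] at d₀₃ d₁₂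
    have hmm₀ : m 0 * m 0 ≠ 0 := (mul_pos hm₀ hm₀).ne'
    have hx := eq_of_inv_cube_eq (K := -κ / (m 0 * m 0)) p₀₃ p₁₂ hw₀ hc
      (div_pos (by linarith) (by positivity)) hbase
      (by rw [div_mul_eq_mul_div, eq_div_iff hmm₀]; linear_combination d₀₃)
      (by rw [div_mul_eq_mul_div, eq_div_iff hmm₀]; linear_combination d₁₂)
    exact ⟨hx, by linarith⟩
  refine ⟨⟨fun h => (diag_legs (of_diag h)).2, fun h => (diag_legs (of_legs h)).1⟩, fun h => ?_⟩
  have hw' := h.elim of_diag of_legs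
  obtain ⟨h1, h2⟩ := diag_legs hw'
  refine hq.isIsoscelesTrapezoid (s := w 1) (t := -w 3) hw₁.ne (by linarith) ?_ h1 h2
  rw [← sub_eq_zero, ← hvec, hw'.1, hw'.2]
  module
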